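/- Let $X=[0,1)$ with Lebesgue measure $\mu$ and addition modulo $1$, let $\mathbb D=\{i/2^n : n\ge 0,\ 0\le i<2^n\}\subseteq X$, and let $R=\{(x,x+r):x\in X,\ r\in\mathbb D\}\subseteq X\times X$ with its Borel structure and the right counting measure $\nu(E)=\int_X|\{z:(z,y)\in E\}|\,d\mu(y)$. Let $H=L^2(R,\nu)$, let $\Delta=\{(x,x):x\in X\}$, and let $\Sigma_0$ be the set of bounded Borel functions on $R$ whose support has horizontal and vertical slices of uniformly bounded cardinality. For $a\in\Sigma_0$ let $L_0(a)\in\mathcal B(H)$ be the operator $(L_0(a)\xi)(x,z)=\sum_{y\sim x}a(x,y)\xi(y,z)$, where $y\sim x$ means $(x,y)\in R$. Let $\mathcal R$ be the von Neumann algebra generated by $L_0(\Sigma_0)$ (the dyadic model of the hyperfinite II$_1$ factor), with trace $\tau(T)=\int_X s(T)(x,x)\,d\mu(x)$, where $s:\mathcal R\to H$, $s(T)=T\chi_\Delta$, is the symbol map. For $\alpha\in L^\infty(X,\mu)$ let $D(\alpha)=L_0(d(\alpha))$, where $d(\alpha)(x,x)=\alpha(x)$ and $d(\alpha)=0$ off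 $\Delta$, and let $\mathcal A=\{D(\alpha):\alpha\in L^\infty(X,\mu)\}$. Let $\mathfrak S(R,\mathbf 1)$ be the set of Schur multipliers, that is, of those $\phi\in L^\infty(R,\nu)$ such that the pointwise product $\phi a$ lies in $s(\mathcal R)$ for every $a\in s(\mathcal R)$. Let $\mathfrak A(R)$ be the set of the functions $\phi_u\in L^\infty(R,\nu)$, $u\in\mathcal A\otimes_{\rm eh}\mathcal A$ (extended Haagerup tensor product), that is, of the functions $\phi_u(x,y)=\sum_{i=1}^\infty a_i(x)b_i(y)$ with $a_i,b_i\in L^\infty(X,\mu)$ such that the series $\sum_i D(a_i)D(a_i)^*$ and $\sum_i D(b_i)^*D(b_i)$ converge weak* to bounded operators with uniformly bounded partial sums. Then the inclusion $\mathfrak A(R)\subseteq\mathfrak S(R,\mathbf 1)$ holds and is proper. More precisely, the symbol map $s$ is injective; $\chi_\Delta\in\mathfrak S(R,\mathbf 1)$; its Schur multiplication map $M(\chi_\Delta):\mathcal R\to\mathcal R$, $T\mapsto s^{-1}(\chi_\Delta\, s(T))$, is the $\tau$-preserving conditional expectation of $\mathcal R$ onto $\mathcal A$ (a linear, contractive,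 positive, faithful, idempotent $\mathcal A$-bimodule map with range $\mathcal A$ that preserves $\tau$); and $\chi_\Delta\notin\mathfrak A(R)$. -/

import Mathlib

open MeasureTheory
open scoped ENNReal

noncomputable section

namespace DyadicCartan

/-- The space `[0,1)` with addition modulo `1`, its Borel structure and Lebesgue measure. -/
abbrev X : Type := UnitAddCircle

/-- The subgroup of the dyadic rationals `i / 2 ^ n` modulo `1`. -/
def dyadic : AddSubgroup X where
  carrier := {r | ∃ (n : ℕ) (i : ℤ), r = (((i : ℝ) / 2 ^ n : ℝ) : X)}
  zero_mem' := ⟨0, 0, by simp⟩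
  add_mem' := by
    rintro _ _ ⟨n, i, rfl⟩ ⟨m, j, rfl⟩
    refine ⟨n + m, i * 2 ^ m + j * 2 ^ n, ?_⟩
    rw [← AddCircle.coe_add]
    congr 1
    push_cast
    rw [pow_add]
    field_simp
  neg_mem' := by
    rintro _ ⟨n, i, rfl⟩
    refine ⟨n, -i, ?_⟩
    rw [← AddCircle.coe_neg]
    congr 1
    push_cast
    ring

instance : Countable dyadic := by
  have h : (dyadic : Set X) ⊆
      Set.range (fun q : ℕ × ℤ => (((q.2 : ℝ) / 2 ^ q.1 : ℝ) : X)) := by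
    rintro _ ⟨n, i, rfl⟩
    exact ⟨(n, i), rfl⟩
  exact ((Set.countable_range _).mono h).to_subtype

/-- The orbit equivalence relation `{(x, x + r) : x ∈ X, r ∈ dyadic}`, a subset of `X × X` with the
relative Borel structure. -/
def R : Set (X × X) := {p | p.2 - p.1 ∈ dyadic}

lemma R_refl (x : X) : (x, x) ∈ R := by
  simp [R]

lemma R_symm {x y : X} (h : (x, y) ∈ R) : (y, x) ∈ R := by
  have := dyadic.neg_mem h
  simpa [R] using this

lemma R_trans {x y z : X} (h : (x, y) ∈ R) (h' : (y, z) ∈ R) : (x, z) ∈ R := by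
  have := dyadic.add_mem h' h
  simpa [R] using this

/-- The horizontal slice `{z : (z, y) ∈ E}` of `E ⊆ R`. -/
def hSlice (E : Set R) (y : X) : Set X := {z | ∃ h : (z, y) ∈ R, (⟨(z, y), h⟩ : R) ∈ E}

/-- The vertical slice `{z : (x, z) ∈ E}` of `E ⊆ R`. -/
def vSlice (E : Set R) (x : X) : Set X := {z | ∃ h : (x, z) ∈ R, (⟨(x, z), h⟩ : R) ∈ E}

lemma add_mem_R (r : dyadic) (y : X) : (y + (r : X), y) ∈ R :=
  R_symm (by simp [R])

lemma hSlice_encard (E : Set R) (y : X) :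
    ((hSlice E y).encard : ℝ≥0∞) =
      ∑' r : dyadic, Set.indicator {y : X | (⟨(y + (r : X), y), add_mem_R r y⟩ : R) ∈ E} 1 y := by
  have h1 : hSlice E y = (fun r : dyadic => y + (r : X)) ''
      {r : dyadic | (⟨(y + (r : X), y), add_mem_R r y⟩ : R) ∈ E} := by
    ext z
    constructor
    · rintro ⟨h, hz⟩
      have h2 : y + (z - y) = z := by abel
      refine ⟨⟨z - y, R_symm h⟩, ?_, h2⟩
      simpa only [Set.mem_ofPred_eq, h2] using hz
    · rintro ⟨r, hr, rfl⟩
      exact ⟨add_mem_R r y, hr⟩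
  have hinj : Function.Injective (fun r : dyadic => y + (r : X)) := fun r s h =>
    Subtype.ext (add_left_cancel h)
  rw [h1, hinj.encard_image, ← ENNReal.tsum_set_one,
    tsum_subtype (f := fun _ : dyadic => (1 : ℝ≥0∞))]
  rfl

lemma measurable_hSlice_encard {E : Set R} (hE : MeasurableSet E) :
    Measurable fun y => ((hSlice E y).encard : ℝ≥0∞) := by
  simp_rw [hSlice_encard]
  refine Measurable.tsum fun r => ?_
  refine measurable_one.indicator ?_
  have h : Measurable fun y : X => (⟨(y + (r : X), y), add_mem_R r y⟩ : R) :=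
    ((measurable_id.add_const _).prodMk measurable_id).subtype_mk
  exact h hE

/-- The right counting measure: `ν E = ∫ |E_y| dμ(y)`. -/
def ν : Measure R :=
  Measure.ofMeasurable (fun E _ => ∫⁻ y : X, ((hSlice E y).encard : ℝ≥0∞))
    (by simp [hSlice])
    (by
      intro E hE hd
      rw [← lintegral_tsum fun n => (measurable_hSlice_encard (hE n)).aemeasurable]
      refine lintegral_congr fun y => ?_
      simp_rw [hSlice_encard]
      rw [ENNReal.tsum_comm]
      refine tsum_congr fun r => ?_
      have h := measure_iUnion (μ := Measure.dirac (⟨(y + (r : X), y), add_mem_R r y⟩ : R)) hd hE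
      simp_rw [Measure.dirac_apply' _ (MeasurableSet.iUnion hE), Measure.dirac_apply' _ (hE _)] at h
      exact h)

lemma ν_apply {E : Set R} (hE : MeasurableSet E) :
    ν E = ∫⁻ y : X, ((hSlice E y).encard : ℝ≥0∞) :=
  Measure.ofMeasurable_apply E hE

/-- The Hilbert space `L²(R, ν)`. -/
abbrev H : Type := Lp ℂ 2 ν

/-- The algebra `L^∞(R, ν)`. -/
abbrev LInf : Type := Lp ℂ ∞ ν

/-- The diagonal of `R`. -/
def Δ : Set R := {p | p.1.1 = p.1.2}

lemma measurableSet_Δ : MeasurableSet Δ :=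
  measurableSet_eq_fun (measurable_fst.comp measurable_subtype_coe)
    (measurable_snd.comp measurable_subtype_coe)

lemma ν_Δ : ν Δ = 1 := by
  have h : ∀ y, hSlice Δ y = {y} := fun y => by
    ext z
    constructor
    · rintro ⟨_, hz⟩
      exact hz
    · rintro rfl
      exact ⟨R_refl _, rfl⟩
  simp [ν_apply measurableSet_Δ, h]

lemma ν_Δ_ne_top : ν Δ ≠ ∞ := by simp [ν_Δ]

/-- The characteristic function of the diagonal, as a vector of `L²(R, ν)`. -/
def chiΔ : H := indicatorConstLp 2 measurableSet_Δ ν_Δ_ne_top (1 : ℂ)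

/-- The characteristic function of the diagonal, as an element of `L^∞(R, ν)`. -/
def chiΔInf : LInf := indicatorConstLp ∞ measurableSet_Δ ν_Δ_ne_top (1 : ℂ)

/-- `E` is band limited: the cardinalities of all its slices are uniformly bounded. -/
def BandLimited (E : Set R) : Prop :=
  (⨆ (x : X) (y : X), (hSlice E y).encard + (vSlice E x).encard) < ⊤

/-- The left finite functions `Σ₀`: bounded Borel functions with band limited support. -/
structure LeftFinite (a : R → ℂ) : Prop where
  measurable : Measurable a
  bounded : ∃ C : ℝ, ∀ p, ‖a p‖ ≤ C
  bandLimited : BandLimited (Function.support a)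

/-- The convolution `(a * ξ)(x, z) = ∑_{y ∼ x} a(x, y) ξ(y, z)` (for the trivial cocycle). For left
finite `a` the sum is finite. -/
def conv (a ξ : R → ℂ) (p : R) : ℂ :=
  ∑' y : {y : X // (p.1.1, y) ∈ R},
    a ⟨(p.1.1, y.1), y.2⟩ * ξ ⟨(y.1, p.1.2), R_trans (R_symm y.2) p.2⟩

/-- `T` is the operator `L₀(a) : ξ ↦ a * ξ` on `L²(R, ν)`. -/
def IsL₀ (a : R → ℂ) (T : H →L[ℂ] H) : Prop :=
  ∀ ξ : H, T ξ =ᵐ[ν] conv a ξ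

/-- The range `L₀(Σ₀)`. -/
def M₀ : Set (H →L[ℂ] H) := {T | ∃ a, LeftFinite a ∧ IsL₀ a T}

/-- The von Neumann algebra generated by a set `S` of operators: the double commutant of
`S ∪ star S`. -/
def vonNeumannGenerated (S : Set (H →L[ℂ] H)) : VonNeumannAlgebra H where
  toStarSubalgebra :=
    StarSubalgebra.centralizer ℂ (StarSubalgebra.centralizer ℂ S : Set (H →L[ℂ] H))
  centralizer_centralizer' := by simp

/-- The von Neumann algebra `M(R)`. -/
def vNAlg : VonNeumannAlgebra H := vonNeumannGenerated M₀

/-- The type of elements of `M(R)`. -/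
abbrev M : Type := vNAlg.toStarSubalgebra

/-- The symbol map `s(T) = T χ_Δ`. -/
def symbol (T : M) : H := (T : H →L[ℂ] H) chiΔ

/-- The symbol set `Σ(R) = s(M(R))`. -/
def symbolSet : Set H := Set.range symbol

/-- The inverse symbol map `L`, the inverse of the (injective) symbol map on its range. -/
def invSymbol : H → M := Function.invFun symbol

/-- The pointwise product of a function in `L^∞(R, ν)` and a function in `L²(R, ν)`. -/
def pmul (φ : LInf) (a : H) : H := φ • a

/-- The Schur multipliers of `M(R)`: those `φ ∈ L^∞(R, ν)` whose pointwise product with every symbol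
is a symbol. -/
def schurMultipliers : Set LInf := {φ | ∀ a ∈ symbolSet, pmul φ a ∈ symbolSet}

/-- The Schur multiplication map `M(φ) : T ↦ L(φ ⋆ s(T))`. -/
def schurMap (φ : LInf) (T : M) : M := invSymbol (pmul φ (symbol T))

/-- Bounded Borel functions on `X`; they represent exactly the elements of `L^∞(X, μ)`. -/
structure BoundedBorel (α : X → ℂ) : Prop where
  measurable : Measurable α
  bounded : ∃ C : ℝ, ∀ x, ‖α x‖ ≤ C

open Classical in
/-- The function `d(α)` on `R`, equal to `α(x)` at `(x, x)` and to `0` off the diagonal. -/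
def d (α : X → ℂ) (p : R) : ℂ := if p.1.1 = p.1.2 then α p.1.1 else 0

/-- `T` is the operator `D(α) = L₀(d(α))`. -/
def IsD (α : X → ℂ) (T : H →L[ℂ] H) : Prop := IsL₀ (d α) T

/-- The Cartan masa `A(R) = {D(α) : α ∈ L^∞(X, μ)}`. -/
def cartanMasa : Set (H →L[ℂ] H) := {T | ∃ α, BoundedBorel α ∧ IsD α T}

/-- A series `u = ∑ A i ⊗ B i` representing an element of the extended Haagerup tensor product
`A(R) ⊗_eh A(R)`: the series `∑ A i (A i)*` and `∑ (B i)* B i` converge weak*, with sums of norm at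
most `C`. Since their terms are positive, this says that all partial sums have norm at most `C`. -/
structure EhSeries where
  A : ℕ → H →L[ℂ] H
  B : ℕ → H →L[ℂ] H
  A_mem : ∀ i, A i ∈ cartanMasa
  B_mem : ∀ i, B i ∈ cartanMasa
  bounded : ∃ C : ℝ, ∀ n, ‖∑ i ∈ Finset.range n, A i * star (A i)‖ ≤ C ∧
    ‖∑ i ∈ Finset.range n, star (B i) * B i‖ ≤ C

/-- `φ = φ_u`: the restriction to `R` of `f_u(x, y) = ∑ a_i(x) b_i(y)`, where `D(a_i) = A_i` and
`D(b_i) = B_i`. The choice of the representatives `a_i, b_i` affects `f_u` on a marginally null set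
only, hence does not affect its class in `L^∞(R, ν)`. -/
def IsEhSymbol (u : EhSeries) (φ : LInf) : Prop :=
  ∃ a b : ℕ → X → ℂ,
    (∀ i, BoundedBorel (a i) ∧ IsD (a i) (u.A i)) ∧
    (∀ i, BoundedBorel (b i) ∧ IsD (b i) (u.B i)) ∧
    φ =ᵐ[ν] fun p => ∑' i, a i p.1.1 * b i p.1.2

/-- The set of all `φ_u` with `u ∈ A(R) ⊗_eh A(R)`. -/
def ehMultipliers : Set LInf := {φ | ∃ u : EhSeries, IsEhSymbol u φ}

/-- The trace `τ(T) = ∫ s(T)(x, x) dμ(x)`. -/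
def trace (T : M) : ℂ := ∫ x : X, symbol T ⟨(x, x), R_refl x⟩

/-- `E` is the trace-preserving conditional expectation of `M(R)` onto the Cartan masa `A(R)`: a
linear, contractive, positive and faithful idempotent with range `A(R)` which is an
`A(R)`-bimodule map and preserves the trace. -/
structure IsCondExpOntoMasa (E : M → M) : Prop where
  map_add : ∀ S T, E (S + T) = E S + E T
  map_smul : ∀ (c : ℂ) T, E (c • T) = c • E T
  norm_le : ∀ T, ‖E T‖ ≤ ‖T‖
  positive : ∀ T : M, (T : H →L[ℂ] H).IsPositive → (E T : H →L[ℂ] H).IsPositive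
  faithful : ∀ T : M, E (star T * T) = 0 → T = 0
  range_eq : Set.range (fun T => (E T : H →L[ℂ] H)) = cartanMasa
  map_of_mem : ∀ T : M, (T : H →L[ℂ] H) ∈ cartanMasa → E T = T
  bimodule : ∀ A B T : M, (A : H →L[ℂ] H) ∈ cartanMasa → (B : H →L[ℂ] H) ∈ cartanMasa →
    E (A * T * B) = A * E T * B
  trace_eq : ∀ T, trace (E T) = trace T

end DyadicCartan

end

open MeasureTheory
open scoped ENNReal

noncomputable section

namespace DyadicCartan

open Filter Topology

/-! ### The structure of the measure `ν` -/

/-! Properness comes from continuity. For φ_u the square sums of the coefficients are finite: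
applying the row and column bounds to χ_Δ gives Σ‖a_i‖₂² < ∞ and Σ‖b_i‖₂² < ∞. Hence r ↦ ∫ Σ
a_i(y+r) b_i(y) dy is a uniformly convergent sum of correlations of L² functions, so it is
continuous on the circle (`continuous_integral_tsum`). For χ_Δ the same integral is 1 at r = 0 and 0
at r = 2⁻ⁿ for n ≥ 1, although these points tend to 0 (`indicator_Δ_not_ae_eq_tsum`).

The rest uses operators acting on the second coordinate only: column shifts and multiplications by
functions of the column. They commute with all left convolutions, hence with the whole algebra, and
χ_Δ is cyclic for them. So χ_Δ is separating and s is injective (`eq_zero_of_symbol_eq_zero`).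
Testing T on the diagonal over a Borel set shows that the diagonal of s(T) is essentially bounded by
‖T‖ (`ae_norm_symbol_diag_le`). Thus χ_Δ s(T) is the symbol of some D(α), and the properties of the
expectation are read off from symbols or from α.

For the inclusion, Σ A_i T B_i converges strongly inside the algebra (`summable_apply_apply`,
`exists_strong_sum`), and its symbol is φ_u s(T), because D(a) T D(b) has symbol a(x) s(T)(x,y) b(y)
(`symbol_bimodule`). -/

/-- The section `y ↦ (y + r, y)` of `R`. -/
def fiber (r : dyadic) (y : X) : R := ⟨(y + (r : X), y), add_mem_R r y⟩

/-- The diagonal embedding of `X` into `R`. -/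
def diag (x : X) : R := ⟨(x, x), R_refl x⟩

lemma fiber_zero : fiber 0 = diag := by
  funext y
  exact Subtype.ext (Prod.ext (by simp [fiber, diag]) rfl)

lemma mk_eq_fiber {y z : X} (h : (y, z) ∈ R) : (⟨(y, z), h⟩ : R) = fiber ⟨y - z, R_symm h⟩ z :=
  Subtype.ext (Prod.ext (by simp [fiber]) rfl)

lemma measurable_fiber (r : dyadic) : Measurable (fiber r) :=
  ((measurable_id.add_const _).prodMk measurable_id).subtype_mk

lemma measurable_left : Measurable fun p : R => p.1.1 :=
  measurable_fst.comp measurable_subtype_coe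

lemma measurable_right : Measurable fun p : R => p.1.2 :=
  measurable_snd.comp measurable_subtype_coe

lemma measurableEmbedding_fiber (r : dyadic) : MeasurableEmbedding (fiber r) := by
  refine MeasurableEmbedding.of_measurable_inverse (g := fun p : R => p.1.2) (measurable_fiber r)
    ?_ measurable_right fun _ => rfl
  have : Set.range (fiber r) = {p : R | p.1.1 = p.1.2 + (r : X)} := by
    ext p
    constructor
    · rintro ⟨y, rfl⟩
      rfl
    · intro hp
      exact ⟨p.1.2, Subtype.ext (Prod.ext hp.symm rfl)⟩
  rw [this]
  exact measurableSet_eq_fun measurable_left (measurable_right.add_const _)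

lemma measurable_diag : Measurable diag := fiber_zero ▸ measurable_fiber 0

lemma measurableEmbedding_diag : MeasurableEmbedding diag :=
  fiber_zero ▸ measurableEmbedding_fiber 0

/-- Over y the slice of `R` is {y + r : r dyadic}, so ν is a countable sum of copies of Lebesgue
measure on graphs of translations. Almost everywhere statements can then be checked one graph at a
time. -/
lemma ν_eq_sum : ν = Measure.sum fun r : dyadic => (volume : Measure X).map (fiber r) := by
  ext E hE
  rw [ν_apply hE, Measure.sum_apply _ hE]
  simp_rw [hSlice_encard]
  refine (lintegral_tsum fun r =>
    (measurable_one.indicator (measurable_fiber r hE)).aemeasurable).trans ?_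
  refine tsum_congr fun r => ?_
  rw [Measure.map_apply (measurable_fiber r) hE]
  exact lintegral_indicator_one (measurable_fiber r hE)

lemma ae_ν_iff {P : R → Prop} :
    (∀ᵐ p ∂ν, P p) ↔ ∀ r : dyadic, ∀ᵐ y : X, P (fiber r y) := by
  rw [ν_eq_sum, Measure.ae_sum_iff]
  exact forall_congr' fun r => (measurableEmbedding_fiber r).ae_map_iff

/-- Countability of the dyadics lets the quantifier over r pass inside the almost everywhere
statement. This form suits `conv`, which sums over a whole column. -/
lemma ae_ν_iff_column {P : R → Prop} :
    (∀ᵐ p ∂ν, P p) ↔ ∀ᵐ z : X, ∀ (y : X) (h : (y, z) ∈ R), P ⟨(y, z), h⟩ := by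
  rw [ae_ν_iff, ← ae_all_iff]
  refine ⟨fun h => h.mono fun z hz y hy => ?_, fun h => h.mono fun z hz r => hz _ _⟩
  rw [mk_eq_fiber]
  exact hz _

lemma ae_diag {P : R → Prop} (h : ∀ᵐ p ∂ν, P p) : ∀ᵐ x : X, P (diag x) := by
  have := ae_ν_iff.1 h 0
  rwa [fiber_zero] at this

lemma ae_add_right {Q : X → Prop} (r : X) (h : ∀ᵐ x : X, Q x) : ∀ᵐ x : X, Q (x + r) :=
  (measurePreserving_add_right (volume : Measure X) r).quasiMeasurePreserving.ae h

lemma ae_left {Q : X → Prop} (h : ∀ᵐ x : X, Q x) : ∀ᵐ p : R ∂ν, Q p.1.1 :=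
  ae_ν_iff.2 fun r => ae_add_right (r : X) h

lemma ae_right {Q : X → Prop} (h : ∀ᵐ x : X, Q x) : ∀ᵐ p : R ∂ν, Q p.1.2 :=
  ae_ν_iff.2 fun _ => h

lemma restrict_Δ : ν.restrict Δ = (volume : Measure X).map diag := by
  ext E hE
  rw [Measure.restrict_apply hE, ν_apply (hE.inter measurableSet_Δ),
    Measure.map_apply measurable_diag hE, ← lintegral_indicator_one (measurable_diag hE)]
  refine lintegral_congr fun y => ?_
  by_cases hy : diag y ∈ E
  · have : hSlice (E ∩ Δ) y = {y} := by
      ext z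
      constructor
      · rintro ⟨_, -, hz⟩
        exact hz
      · rintro rfl
        exact ⟨R_refl _, hy, rfl⟩
    simp [this, hy]
  · have : hSlice (E ∩ Δ) y = ∅ := by
      ext z
      refine ⟨?_, fun h => h.elim⟩
      rintro ⟨h, hE, hz⟩
      obtain rfl : z = y := hz
      exact hy hE
    simp [this, hy]

lemma setIntegral_Δ {F : Type*} [NormedAddCommGroup F] [NormedSpace ℝ F] (f : R → F) :
    ∫ p in Δ, f p ∂ν = ∫ x : X, f (diag x) := by
  rw [restrict_Δ, measurableEmbedding_diag.integral_map]

lemma integrable_diag {F : Type*} [NormedAddCommGroup F] {f : R → F} (hf : IntegrableOn f Δ ν) :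
    Integrable (fun x : X => f (diag x)) := by
  rw [IntegrableOn, restrict_Δ, measurableEmbedding_diag.integrable_map_iff] at hf
  exact hf

/-! ### Multiplication operators and column shifts -/

/-- `T` is the operator of multiplication by `g`. -/
def IsMul (g : R → ℂ) (T : H →L[ℂ] H) : Prop := ∀ ξ : H, T ξ =ᵐ[ν] fun p => g p * ξ p

lemma exists_isMul {g : R → ℂ} (hg : Measurable g) {C : ℝ} (hC : ∀ p, ‖g p‖ ≤ C) :
    ∃ T, IsMul g T := by
  have h : MemLp g ∞ ν := memLp_top_of_bound hg.aestronglyMeasurable C (ae_of_all _ hC)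
  refine ⟨(ContinuousLinearMap.lsmul ℂ ℂ).holderL ν ∞ 2 2 h.toLp, fun ξ => ?_⟩
  filter_upwards [(ContinuousLinearMap.lsmul ℂ ℂ).coeFn_holder (r := 2) h.toLp ξ, h.coeFn_toLp]
    with p h1 h2
  refine h1.trans ?_
  simp [h2]

lemma IsMul.norm_apply_le {g : R → ℂ} {T : H →L[ℂ] H} (hT : IsMul g T) {C : ℝ}
    (hC : ∀ p, ‖g p‖ ≤ C) (ξ : H) : ‖T ξ‖ ≤ C * ‖ξ‖ := by
  refine Lp.norm_le_mul_norm_of_ae_le_mul ?_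
  filter_upwards [hT ξ] with p hp
  rw [hp, norm_mul]
  gcongr
  exact hC p

lemma IsMul.star {g : R → ℂ} {T : H →L[ℂ] H} (hT : IsMul g T) (hg : Measurable g) {C : ℝ}
    (hC : ∀ p, ‖g p‖ ≤ C) : IsMul (fun p => starRingEnd ℂ (g p)) (star T) := by
  obtain ⟨S, hS⟩ := exists_isMul (g := fun p => starRingEnd ℂ (g p)) (by fun_prop) (C := C)
    (fun p => by simpa using hC p)
  suffices S = Star.star T by rwa [← this]
  rw [ContinuousLinearMap.star_eq_adjoint, ContinuousLinearMap.eq_adjoint_iff]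
  intro ξ η
  rw [L2.inner_def, L2.inner_def]
  refine integral_congr_ae ?_
  filter_upwards [hT η, hS ξ] with p h1 h2
  rw [h1, h2]
  simp only [RCLike.inner_apply, map_mul, starRingEnd_self_apply]
  ring

/-- The column shift `(x, z) ↦ (x, z + s)` of `R`. -/
def shift (s : dyadic) (p : R) : R :=
  ⟨(p.1.1, p.1.2 + (s : X)), R_trans p.2 (by simp [R])⟩

lemma shift_zero (p : R) : shift 0 p = p := Subtype.ext (Prod.ext rfl (by simp [shift]))

lemma shift_shift_neg (s : dyadic) (p : R) : shift s (shift (-s) p) = p :=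
  Subtype.ext (Prod.ext rfl (by simp [shift]))

lemma measurable_shift (s : dyadic) : Measurable (shift s) :=
  (measurable_left.prodMk (measurable_right.add_const _)).subtype_mk

/-- The slice over y of the preimage of E is the slice of E over y + s, so translation invariance of
Lebesgue measure suffices. -/
lemma measurePreserving_shift (s : dyadic) : MeasurePreserving (shift s) ν ν := by
  refine ⟨measurable_shift s, ?_⟩
  ext E hE
  rw [Measure.map_apply (measurable_shift s) hE, ν_apply (measurable_shift s hE), ν_apply hE,
    ← lintegral_add_right_eq_self (fun y : X => ((hSlice E y).encard : ℝ≥0∞)) (s : X)]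
  refine lintegral_congr fun y => ?_
  congr 2
  ext z
  constructor
  · rintro ⟨h, hz⟩
    exact ⟨_, hz⟩
  · rintro ⟨h, hz⟩
    exact ⟨R_trans h (R_symm (by simp [R])), hz⟩

/-- The unitary operator on `L²(R, ν)` induced by a column shift. -/
def shiftOp (s : dyadic) : H →L[ℂ] H :=
  (Lp.compMeasurePreservingₗᵢ ℂ (shift s) (measurePreserving_shift s)).toContinuousLinearMap

lemma shiftOp_apply (s : dyadic) (ξ : H) : shiftOp s ξ =ᵐ[ν] fun p => ξ (shift s p) :=
  Lp.coeFn_compMeasurePreserving ξ (measurePreserving_shift s)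

lemma shiftOp_neg_shiftOp (s : dyadic) (ξ : H) : shiftOp (-s) (shiftOp s ξ) = ξ := by
  refine Lp.ext ?_
  filter_upwards [shiftOp_apply (-s) (shiftOp s ξ),
    (measurePreserving_shift (-s)).quasiMeasurePreserving.ae (shiftOp_apply s ξ)] with p h1 h2
  rw [h1, h2, shift_shift_neg]

lemma inner_shiftOp (s : dyadic) (ξ η : H) :
    inner ℂ (shiftOp s ξ) (shiftOp s η) = inner ℂ ξ η :=
  (Lp.compMeasurePreservingₗᵢ ℂ (shift s) (measurePreserving_shift s)).inner_map_map ξ η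

lemma star_shiftOp (s : dyadic) : star (shiftOp s) = shiftOp (-s) := by
  refine Eq.symm ?_
  rw [ContinuousLinearMap.star_eq_adjoint, ContinuousLinearMap.eq_adjoint_iff]
  intro ξ η
  rw [← inner_shiftOp (-s) ξ, shiftOp_neg_shiftOp]

/-- `W` acts on columns, by a column shift followed by multiplication by a function of the
column. -/
def ActsOnColumns (W : H →L[ℂ] H) : Prop :=
  ∃ (f : X → ℂ) (s : dyadic), ∀ ξ : H, W ξ =ᵐ[ν] fun p => f p.1.2 * ξ (shift s p)

lemma actsOnColumns_shiftOp (s : dyadic) : ActsOnColumns (shiftOp s) :=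
  ⟨fun _ => 1, s, fun ξ => by simpa using shiftOp_apply s ξ⟩

lemma IsMul.actsOnColumns {f : X → ℂ} {W : H →L[ℂ] H} (hW : IsMul (fun p => f p.1.2) W) :
    ActsOnColumns W :=
  ⟨f, 0, fun ξ => by simpa only [shift_zero] using hW ξ⟩

lemma conv_congr (a : R → ℂ) {ξ η : R → ℂ} (h : ξ =ᵐ[ν] η) : conv a ξ =ᵐ[ν] conv a η := by
  refine ae_ν_iff_column.2 ((ae_ν_iff_column.1 h).mono fun z hz y hy => ?_)
  refine tsum_congr fun w => ?_
  congr 1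
  exact hz _ _

lemma conv_mul_shift (a ξ : R → ℂ) (f : X → ℂ) (s : dyadic) (p : R) :
    conv a (fun q => f q.1.2 * ξ (shift s q)) p = f p.1.2 * conv a ξ (shift s p) := by
  rw [conv, conv, ← tsum_mul_left]
  refine tsum_congr fun w => ?_
  simp only [shift]
  ring

/-- Left convolution mixes first coordinates within a fixed column, while W only moves and rescales
whole columns. -/
lemma ActsOnColumns.commute {W T : H →L[ℂ] H} (hW : ActsOnColumns W) {a : R → ℂ}
    (hT : IsL₀ a T) : T * W = W * T := by
  obtain ⟨f, s, hW⟩ := hW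
  refine ContinuousLinearMap.ext fun ξ => Lp.ext ?_
  filter_upwards [hT (W ξ), conv_congr a (hW ξ), hW (T ξ),
    (measurePreserving_shift s).quasiMeasurePreserving.ae (hT ξ)] with p h1 h2 h3 h4
  rw [mul_apply_eq_comp, mul_apply_eq_comp, h1, h2, h3, h4,
    conv_mul_shift]

/-! ### Membership in the von Neumann algebra -/

lemma mem_vNAlg_iff {T : H →L[ℂ] H} : T ∈ vNAlg.toStarSubalgebra ↔
    ∀ W ∈ StarSubalgebra.centralizer ℂ M₀, W * T = T * W := by
  have : T ∈ vNAlg.toStarSubalgebra ↔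
      T ∈ StarSubalgebra.centralizer ℂ (StarSubalgebra.centralizer ℂ M₀ : Set (H →L[ℂ] H)) :=
    Iff.rfl
  rw [this, StarSubalgebra.mem_centralizer_iff]
  exact ⟨fun h W hW => (h W hW).1, fun h W hW => ⟨h W hW, h _ (star_mem hW)⟩⟩

lemma M₀_subset {T : H →L[ℂ] H} (hT : T ∈ M₀) : T ∈ vNAlg.toStarSubalgebra :=
  mem_vNAlg_iff.2 fun _ hW => ((StarSubalgebra.mem_centralizer_iff ℂ).1 hW T hT).1.symm

lemma mem_centralizer_of_actsOnColumns {W : H →L[ℂ] H} (hW : ActsOnColumns W)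
    (hW' : ActsOnColumns (star W)) : W ∈ StarSubalgebra.centralizer ℂ M₀ := by
  rw [StarSubalgebra.mem_centralizer_iff]
  rintro T ⟨a, -, hT⟩
  refine ⟨hW.commute hT, ?_⟩
  -- The centralizer also requires W to commute with T*; this is the adjoint of the relation T W* =
  -- W* T.
  have := congrArg star (hW'.commute hT)
  simpa using this.symm

lemma shiftOp_commute (s : dyadic) (T : M) (ξ : H) :
    (T : H →L[ℂ] H) (shiftOp s ξ) = shiftOp s ((T : H →L[ℂ] H) ξ) := by
  have := mem_vNAlg_iff.1 T.2 (shiftOp s) (mem_centralizer_of_actsOnColumns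
    (actsOnColumns_shiftOp s) (star_shiftOp s ▸ actsOnColumns_shiftOp (-s)))
  exact (DFunLike.congr_fun this ξ).symm

lemma BoundedBorel.exists_right {f : X → ℂ} (hf : BoundedBorel f) :
    ∃ N, IsMul (fun p => f p.1.2) N :=
  let ⟨_, hC⟩ := hf.bounded
  exists_isMul (hf.measurable.comp measurable_right) fun p => hC p.1.2

lemma IsMul.commute_right {f : X → ℂ} {N : H →L[ℂ] H} (hN : IsMul (fun p => f p.1.2) N)
    (hf : BoundedBorel f) (T : M) (ξ : H) :
    (T : H →L[ℂ] H) (N ξ) = N ((T : H →L[ℂ] H) ξ) := by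
  obtain ⟨C, hC⟩ := hf.bounded
  have h := hN.star (hf.measurable.comp measurable_right) fun p => hC p.1.2
  have := mem_vNAlg_iff.1 T.2 N (mem_centralizer_of_actsOnColumns hN.actsOnColumns
    (IsMul.actsOnColumns (f := fun x => starRingEnd ℂ (f x)) h))
  exact (DFunLike.congr_fun this ξ).symm

/-! ### The Cartan masa -/

lemma conv_d (α : X → ℂ) (ξ : R → ℂ) (p : R) : conv (d α) ξ p = α p.1.1 * ξ p := by
  rw [conv, tsum_eq_single ⟨p.1.1, R_refl _⟩]
  · simp [d]
  · intro w hw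
    have : p.1.1 ≠ w.1 := fun h => hw (Subtype.ext h.symm)
    simp [d, this]

lemma isD_iff {α : X → ℂ} {T : H →L[ℂ] H} : IsD α T ↔ IsMul (fun p => α p.1.1) T := by
  refine forall_congr' fun ξ => ?_
  rw [funext (conv_d α ξ)]

lemma leftFinite_d {α : X → ℂ} (hα : BoundedBorel α) : LeftFinite (d α) where
  measurable := Measurable.ite measurableSet_Δ (hα.measurable.comp measurable_left)
    measurable_const
  bounded := by
    obtain ⟨C, hC⟩ := hα.bounded
    refine ⟨C, fun p => ?_⟩
    rw [d]
    split_ifs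
    · exact hC _
    · simpa using (norm_nonneg _).trans (hC p.1.1)
  bandLimited := by
    have hd : ∀ p, p ∈ Function.support (d α) → p.1.1 = p.1.2 := by
      intro p hp
      by_contra h
      simp [d, h] at hp
    have h1 : ∀ y, (hSlice (Function.support (d α)) y).encard ≤ 1 := fun y => by
      refine (Set.encard_le_encard ?_).trans (Set.encard_singleton y).le
      rintro z ⟨h, hz⟩
      exact hd _ hz
    have h2 : ∀ x, (vSlice (Function.support (d α)) x).encard ≤ 1 := fun x => by
      refine (Set.encard_le_encard ?_).trans (Set.encard_singleton x).le
      rintro z ⟨h, hz⟩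
      exact (hd _ hz).symm
    refine lt_of_le_of_lt (iSup₂_le fun x y => add_le_add (h1 y) (h2 x)) ?_
    exact WithTop.coe_lt_top _

lemma BoundedBorel.exists_left {α : X → ℂ} (hα : BoundedBorel α) :
    ∃ D, IsMul (fun p => α p.1.1) D :=
  let ⟨_, hC⟩ := hα.bounded
  exists_isMul (hα.measurable.comp measurable_left) fun p => hC p.1.1

lemma IsMul.mem_cartanMasa {α : X → ℂ} {D : H →L[ℂ] H} (hD : IsMul (fun p => α p.1.1) D)
    (hα : BoundedBorel α) : D ∈ cartanMasa :=
  ⟨α, hα, isD_iff.2 hD⟩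

lemma cartanMasa_subset {D : H →L[ℂ] H} (hD : D ∈ cartanMasa) : D ∈ vNAlg.toStarSubalgebra := by
  obtain ⟨α, hα, hD⟩ := hD
  exact M₀_subset ⟨d α, leftFinite_d hα, hD⟩

/-! ### The symbol map -/

lemma chiΔ_ae : chiΔ =ᵐ[ν] Δ.indicator fun _ => 1 := indicatorConstLp_coeFn

/-- The two coordinates agree on Δ. This trades a left multiplication, which need not commute with
T, for a column multiplication, which does. -/
lemma IsMul.left_chiΔ {f : X → ℂ} {D N : H →L[ℂ] H} (hD : IsMul (fun p => f p.1.1) D)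
    (hN : IsMul (fun p => f p.1.2) N) : D chiΔ = N chiΔ := by
  refine Lp.ext ?_
  filter_upwards [hD chiΔ, hN chiΔ, chiΔ_ae] with p h1 h2 h3
  rw [h1, h2, h3]
  by_cases hp : p ∈ Δ
  · rw [show p.1.1 = p.1.2 from hp]
  · simp [hp]

/-- The symbol of `D(a) T D(b)` is `a(x) s(T)(x, y) b(y)`. -/
lemma symbol_bimodule {a b : X → ℂ} {A B : H →L[ℂ] H} (hA : IsMul (fun p => a p.1.1) A)
    (hb : BoundedBorel b) (hB : IsMul (fun p => b p.1.1) B) (T : M) :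
    A ((T : H →L[ℂ] H) (B chiΔ)) =ᵐ[ν] fun p => a p.1.1 * b p.1.2 * symbol T p := by
  obtain ⟨N, hN⟩ := hb.exists_right
  rw [hB.left_chiΔ hN, hN.commute_right hb]
  filter_upwards [hA (N ((T : H →L[ℂ] H) chiΔ)), hN ((T : H →L[ℂ] H) chiΔ)] with p h1 h2
  rw [h1, h2, symbol]
  ring

lemma boundedBorel_indicator {B : Set X} (hB : MeasurableSet B) :
    BoundedBorel (B.indicator fun _ => (1 : ℂ)) where
  measurable := measurable_const.indicator hB
  bounded := ⟨1, fun x => by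
    by_cases h : x ∈ B <;> simp [h]⟩

lemma inner_chiΔ (ξ : H) : inner ℂ chiΔ ξ = ∫ x : X, ξ (diag x) := by
  rw [chiΔ, L2.inner_indicatorConstLp_one, setIntegral_Δ]

lemma integrableOn_Δ (ξ : H) : IntegrableOn ξ Δ ν :=
  integrableOn_Lp_of_measure_ne_top ξ one_le_two ν_Δ_ne_top

lemma IsMul.inner_chiΔ {B : Set X} (hB : MeasurableSet B) {N : H →L[ℂ] H}
    (hN : IsMul (fun p => B.indicator (fun _ => (1 : ℂ)) p.1.2) N) (ξ : H) :
    inner ℂ (N chiΔ) ξ = ∫ x in B, ξ (diag x) := by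
  have : inner ℂ (N chiΔ) ξ = inner ℂ chiΔ (N ξ) := by
    rw [L2.inner_def, L2.inner_def]
    refine integral_congr_ae ?_
    filter_upwards [hN chiΔ, hN ξ] with p h1 h2
    rw [h1, h2]
    by_cases hp : p.1.2 ∈ B <;> simp [hp]
  rw [this, DyadicCartan.inner_chiΔ, ← integral_indicator hB]
  refine integral_congr_ae ((ae_diag (hN ξ)).mono fun x hx => ?_)
  refine hx.trans ?_
  by_cases hp : x ∈ B <;> simp [hp, diag]

/-- Pairing ξ with `N chiΔ` integrates its diagonal over B, and these integrals determine the
diagonal almost everywhere. -/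
lemma ae_diag_eq_zero {ξ : H} (h : ∀ (B : Set X) (N : H →L[ℂ] H), MeasurableSet B →
    IsMul (fun p => B.indicator (fun _ => (1 : ℂ)) p.1.2) N → inner ℂ (N chiΔ) ξ = 0) :
    ∀ᵐ x : X, ξ (diag x) = 0 := by
  refine (integrable_diag (integrableOn_Δ ξ)).ae_eq_zero_of_forall_setIntegral_eq_zero
    fun B hB _ => ?_
  obtain ⟨N, hN⟩ := (boundedBorel_indicator hB).exists_right
  rw [← hN.inner_chiΔ hB]
  exact h B N hB hN

/-- If T χ_Δ = 0, then T kills every shifted truncation of χ_Δ, since shifts and column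
multiplications commute with T. The range of T* is orthogonal to all these vectors, which forces T*
= 0. -/
lemma eq_zero_of_symbol_eq_zero {T : M} (h : symbol T = 0) : T = 0 := by
  suffices hs : star (T : H →L[ℂ] H) = 0 by
    exact Subtype.ext (star_eq_zero.1 hs)
  refine ContinuousLinearMap.ext fun ζ => ?_
  set η : H := star (T : H →L[ℂ] H) ζ with hη
  have key : ∀ s : dyadic, ∀ᵐ x : X, shiftOp (-s) η (diag x) = 0 := by
    refine fun s => ae_diag_eq_zero fun B N hB hN => ?_
    rw [← star_shiftOp, ContinuousLinearMap.star_eq_adjoint,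
      ContinuousLinearMap.adjoint_inner_right, hη, ContinuousLinearMap.star_eq_adjoint,
      ContinuousLinearMap.adjoint_inner_right, shiftOp_commute,
      hN.commute_right (boundedBorel_indicator hB)]
    rw [symbol] at h
    simp [h]
  refine (Lp.eq_zero_iff_ae_eq_zero (f := η)).2 (ae_ν_iff.2 fun r => ?_)
  -- The graph of translation by r is the diagonal moved by the column shift by -r, so vanishing of
  -- all shifted diagonals gives vanishing on every graph.
  have h1 := ae_add_right (r : X) ((key r).and (ae_diag (shiftOp_apply (-r) η)))
  filter_upwards [h1] with y hy
  have h2 : shift (-r) (diag (y + (r : X))) = fiber r y :=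
    Subtype.ext (Prod.ext rfl (by simp [shift, diag, fiber]))
  rw [← h2, ← hy.2, hy.1, Pi.zero_apply]

lemma symbol_injective : Function.Injective symbol := by
  intro S T h
  refine sub_eq_zero.1 (eq_zero_of_symbol_eq_zero ?_)
  simpa [symbol, sub_eq_zero] using h

lemma invSymbol_symbol (T : M) : invSymbol (symbol T) = T :=
  Function.leftInverse_invFun symbol_injective T

/-! ### The conditional expectation onto the Cartan masa -/

lemma integral_diag_norm_sq_le (ξ : H) : ∫ x : X, ‖ξ (diag x)‖ ^ 2 ≤ ‖ξ‖ ^ 2 := by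
  have h : (‖ξ‖ : ℝ) ^ 2 = ∫ p, ‖ξ p‖ ^ 2 ∂ν := by
    have h1 : ((‖ξ‖ ^ 2 : ℝ) : ℂ) = ((∫ p, ‖ξ p‖ ^ 2 ∂ν : ℝ) : ℂ) := by
      have := inner_self_eq_norm_sq_to_K (𝕜 := ℂ) ξ
      rw [L2.inner_def] at this
      rw [← integral_complex_ofReal]
      push_cast
      refine this.symm.trans (integral_congr_ae (ae_of_all _ fun p => ?_))
      simp only [inner_self_eq_norm_sq_to_K]
      simp
    exact_mod_cast h1
  rw [h, ← setIntegral_Δ fun p => ‖ξ p‖ ^ 2]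
  exact setIntegral_le_integral (Lp.memLp ξ).norm.integrable_sq
    (ae_of_all _ fun p => by positivity)

lemma norm_sq_indicator {B : Set X} (hB : MeasurableSet B) {N : H →L[ℂ] H}
    (hN : IsMul (fun p => B.indicator (fun _ => (1 : ℂ)) p.1.2) N) :
    ‖N chiΔ‖ ^ 2 = volume.real B := by
  have h : ((‖N chiΔ‖ ^ 2 : ℝ) : ℂ) = (volume.real B : ℝ) := by
    have := inner_self_eq_norm_sq_to_K (𝕜 := ℂ) (N chiΔ)
    rw [hN.inner_chiΔ hB] at this
    have h2 : ∫ x in B, N chiΔ (diag x) = ∫ x in B, (1 : ℂ) := by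
      refine setIntegral_congr_ae hB ?_
      filter_upwards [ae_diag (hN chiΔ), ae_diag chiΔ_ae] with x h1 h2 hx
      rw [h1, h2]
      have : diag x ∈ Δ := rfl
      simp [this, show (diag x).1.2 ∈ B from hx]
    rw [h2] at this
    push_cast
    exact this.symm.trans (by simp)
  exact_mod_cast h

/-- Let B be the set where the bound fails. Applying T to χ_Δ cut down to B gives ∫_B |s(T)(x,x)|² ≤
‖T‖² μ(B), whereas the integrand exceeds ‖T‖² throughout B. -/
lemma ae_norm_symbol_diag_le (T : M) : ∀ᵐ x : X, ‖symbol T (diag x)‖ ≤ ‖T‖ := by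
  set β : X → ℂ := fun x => symbol T (diag x) with hβ
  have hm : Measurable β := (Lp.stronglyMeasurable (symbol T)).measurable.comp measurable_diag
  set B : Set X := {x | ‖T‖ < ‖β x‖} with hBdef
  have hB : MeasurableSet B := measurableSet_lt measurable_const hm.norm
  obtain ⟨N, hN⟩ := (boundedBorel_indicator hB).exists_right
  have h1 : ‖N (symbol T)‖ ^ 2 ≤ ‖T‖ ^ 2 * volume.real B := by
    rw [symbol, ← hN.commute_right (boundedBorel_indicator hB), ← norm_sq_indicator hB hN,
      ← mul_pow]
    gcongr
    exact (T : H →L[ℂ] H).le_opNorm _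
  have h2 : ∫ x : X, ‖N (symbol T) (diag x)‖ ^ 2 = ∫ x in B, ‖β x‖ ^ 2 := by
    rw [← integral_indicator hB]
    refine integral_congr_ae ((ae_diag (hN (symbol T))).mono fun x hx => ?_)
    simp only [hx]
    by_cases h : x ∈ B
    · simp [h, show (diag x).1.2 ∈ B from h, hβ]
    · simp [h, show (diag x).1.2 ∉ B from h]
  have h3 := (h2 ▸ integral_diag_norm_sq_le (N (symbol T))).trans h1
  have hint : IntegrableOn (fun x => ‖β x‖ ^ 2) B := by
    refine (integrable_diag (f := fun p => ‖symbol T p‖ ^ 2) ?_).integrableOn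
    exact (Lp.memLp (symbol T)).norm.integrable_sq.integrableOn
  have h4 : ∫ x in B, (‖β x‖ ^ 2 - ‖T‖ ^ 2) ≤ 0 := by
    rw [integral_sub hint (integrable_const _)]
    simp only [integral_const, smul_eq_mul, measureReal_restrict_apply_univ]
    linarith
  have hpos : ∀ x ∈ B, 0 < ‖β x‖ ^ 2 - ‖T‖ ^ 2 := fun x hx => by
    have : ‖T‖ < ‖β x‖ := hx
    have h0 := norm_nonneg T
    nlinarith
  have h5 : (fun x => ‖β x‖ ^ 2 - ‖T‖ ^ 2) =ᵐ[volume.restrict B] 0 := by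
    refine (setIntegral_eq_zero_iff_of_nonneg_ae ?_ (hint.sub (integrable_const _))).1
      (le_antisymm h4 (setIntegral_nonneg hB fun x hx => (hpos x hx).le))
    exact (ae_restrict_iff' hB).2 (ae_of_all _ fun x hx => (hpos x hx).le)
  filter_upwards [(ae_restrict_iff' hB).1 h5] with x hx
  by_contra hlt
  exact (hpos x (not_le.1 hlt)).ne' (hx (not_le.1 hlt))

lemma exists_boundedBorel_symbol_diag (T : M) : ∃ α : X → ℂ, BoundedBorel α ∧
    (∀ x, ‖α x‖ ≤ ‖T‖) ∧ ∀ᵐ x : X, symbol T (diag x) = α x := by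
  set β : X → ℂ := fun x => symbol T (diag x) with hβ
  have hm : Measurable β := (Lp.stronglyMeasurable (symbol T)).measurable.comp measurable_diag
  have hB : MeasurableSet {x | ‖β x‖ ≤ ‖T‖} := measurableSet_le hm.norm measurable_const
  have hbd : ∀ x, ‖{x | ‖β x‖ ≤ ‖T‖}.indicator β x‖ ≤ ‖T‖ := fun x => by
    by_cases h : x ∈ {x | ‖β x‖ ≤ ‖T‖}
    · rw [Set.indicator_of_mem h]
      exact h
    · rw [Set.indicator_of_notMem h, norm_zero]
      exact norm_nonneg _
  -- `BoundedBorel` needs a bound at every point, so the diagonal is reset to 0 on the null set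
  -- where it exceeds ‖T‖.
  refine ⟨{x | ‖β x‖ ≤ ‖T‖}.indicator β, ⟨hm.indicator hB, _, hbd⟩, hbd, ?_⟩
  filter_upwards [ae_norm_symbol_diag_le T] with x hx
  exact (Set.indicator_of_mem (s := {x | ‖β x‖ ≤ ‖T‖}) hx β).symm

lemma pmul_ae (φ : LInf) (ξ : H) : pmul φ ξ =ᵐ[ν] fun p => φ p * ξ p :=
  Lp.coeFn_lpSMul φ ξ

lemma pmul_chiΔInf_ae (ξ : H) : pmul chiΔInf ξ =ᵐ[ν] Δ.indicator ξ := by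
  filter_upwards [pmul_ae chiΔInf ξ,
    indicatorConstLp_coeFn (p := ∞) (hs := measurableSet_Δ) (hμs := ν_Δ_ne_top) (c := (1 : ℂ))]
    with p h1 h2
  rw [h1, chiΔInf, h2]
  by_cases hp : p ∈ Δ <;> simp [hp]

lemma exists_schurMap (T : M) : ∃ (α : X → ℂ) (S : M), BoundedBorel α ∧
    (∀ x, ‖α x‖ ≤ ‖T‖) ∧ (∀ᵐ x : X, symbol T (diag x) = α x) ∧
    IsMul (fun p => α p.1.1) (S : H →L[ℂ] H) ∧ symbol S = pmul chiΔInf (symbol T) := by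
  obtain ⟨α, hα, hbd, hae⟩ := exists_boundedBorel_symbol_diag T
  obtain ⟨D, hD⟩ := hα.exists_left
  refine ⟨α, ⟨D, cartanMasa_subset (hD.mem_cartanMasa hα)⟩, hα, hbd, hae, hD, Lp.ext ?_⟩
  filter_upwards [hD chiΔ, chiΔ_ae, pmul_chiΔInf_ae (symbol T), ae_left hae] with p h1 h2 h3 h4
  rw [symbol, h1, h2, h3]
  by_cases hp : p ∈ Δ
  · have : diag p.1.1 = p := Subtype.ext (Prod.ext rfl hp)
    rw [this] at h4
    simp [hp, h4]
  · simp [hp]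

lemma chiΔInf_mem_schurMultipliers : chiΔInf ∈ schurMultipliers := by
  rintro _ ⟨T, rfl⟩
  obtain ⟨_, S, -, -, -, -, hS⟩ := exists_schurMap T
  exact ⟨S, hS⟩

lemma symbol_schurMap (T : M) : symbol (schurMap chiΔInf T) = pmul chiΔInf (symbol T) := by
  obtain ⟨_, S, -, -, -, -, hS⟩ := exists_schurMap T
  rw [schurMap, ← hS, invSymbol_symbol]

lemma symbol_schurMap_ae (T : M) :
    symbol (schurMap chiΔInf T) =ᵐ[ν] Δ.indicator (symbol T) :=
  symbol_schurMap T ▸ pmul_chiΔInf_ae (symbol T)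

lemma schurMap_eq_iff {T S : M} :
    schurMap chiΔInf T = S ↔ symbol S =ᵐ[ν] Δ.indicator (symbol T) := by
  constructor
  · rintro rfl
    exact symbol_schurMap_ae T
  · exact fun h => symbol_injective (Lp.ext ((symbol_schurMap_ae T).trans h.symm))

lemma exists_isMul_schurMap (T : M) : ∃ α : X → ℂ, BoundedBorel α ∧
    (∀ x, ‖α x‖ ≤ ‖T‖) ∧ (∀ᵐ x : X, symbol T (diag x) = α x) ∧
    IsMul (fun p => α p.1.1) (schurMap chiΔInf T : H →L[ℂ] H) := by
  obtain ⟨α, S, h1, h2, h3, h4, hS⟩ := exists_schurMap T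
  refine ⟨α, h1, h2, h3, ?_⟩
  rwa [schurMap, ← hS, invSymbol_symbol]

lemma schurMap_of_mem_cartanMasa {T : M} (hT : (T : H →L[ℂ] H) ∈ cartanMasa) :
    schurMap chiΔInf T = T := by
  obtain ⟨α, -, hα⟩ := hT
  refine schurMap_eq_iff.2 ?_
  filter_upwards [isD_iff.1 hα chiΔ, chiΔ_ae] with p h1 h2
  by_cases hp : p ∈ Δ
  · simp [hp]
  · rw [symbol, h1, h2]
    simp [hp]

lemma trace_eq_inner (T : M) : trace T = inner ℂ chiΔ (symbol T) := (inner_chiΔ _).symm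

lemma trace_schurMap (T : M) : trace (schurMap chiΔInf T) = trace T := by
  refine integral_congr_ae ((ae_diag (symbol_schurMap_ae T)).mono fun x hx => ?_)
  exact hx.trans (Set.indicator_of_mem (s := Δ) (show diag x ∈ Δ from rfl) _)

/-- The vector states of T at `N chiΔ` are the integrals of the diagonal over B, so positivity of T
makes all of them nonnegative reals. -/
lemma symbol_diag_nonneg {T : M} (hT : (T : H →L[ℂ] H).IsPositive) :
    ∀ᵐ x : X, 0 ≤ (symbol T (diag x)).re ∧ (symbol T (diag x)).im = 0 := by
  have hint := integrable_diag (integrableOn_Δ (symbol T))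
  have key : ∀ B : Set X, MeasurableSet B →
      0 ≤ (∫ x in B, symbol T (diag x)).re ∧ (∫ x in B, symbol T (diag x)).im = 0 := by
    intro B hB
    obtain ⟨N, hN⟩ := (boundedBorel_indicator hB).exists_right
    have h1 : inner ℂ (N chiΔ) ((T : H →L[ℂ] H) (N chiΔ)) = ∫ x in B, symbol T (diag x) := by
      rw [hN.commute_right (boundedBorel_indicator hB), hN.inner_chiΔ hB]
      refine setIntegral_congr_ae hB ((ae_diag (hN (symbol T))).mono fun x hx hxB => ?_)
      refine hx.trans ?_
      simp [show (diag x).1.2 ∈ B from hxB]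
    rw [← h1]
    have h2 := hT.inner_nonneg_right (N chiΔ)
    rw [Complex.nonneg_iff] at h2
    exact ⟨h2.1, h2.2.symm⟩
  have hre : ∀ᵐ x : X, 0 ≤ (symbol T (diag x)).re := by
    refine ae_nonneg_of_forall_setIntegral_nonneg hint.re fun B hB _ => ?_
    exact (key B hB).1.trans_eq (integral_re hint.integrableOn).symm
  have him : ∀ᵐ x : X, (symbol T (diag x)).im = 0 := by
    refine hint.im.ae_eq_zero_of_forall_setIntegral_eq_zero fun B hB _ => ?_
    exact (integral_im hint.integrableOn).trans (key B hB).2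
  exact hre.and him

lemma IsMul.isPositive {α : X → ℂ} {D : H →L[ℂ] H} (hD : IsMul (fun p => α p.1.1) D)
    (h : ∀ᵐ x : X, 0 ≤ (α x).re ∧ (α x).im = 0) : D.IsPositive := by
  rw [ContinuousLinearMap.isPositive_iff_complex]
  intro ξ
  have h1 : inner ℂ (D ξ) ξ = ((∫ p : R, (α p.1.1).re * ‖ξ p‖ ^ 2 ∂ν : ℝ) : ℂ) := by
    rw [L2.inner_def, ← integral_complex_ofReal]
    refine integral_congr_ae ?_
    filter_upwards [hD ξ, ae_left h] with p h1 h2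
    have h3 : α p.1.1 = ((α p.1.1).re : ℂ) := Complex.ext rfl (by simp [h2.2])
    rw [h1, RCLike.inner_apply, map_mul, h3, Complex.conj_ofReal]
    have := RCLike.mul_conj (ξ p)
    push_cast
    rw [mul_left_comm, this]
    simp
  rw [h1]
  refine ⟨by simp, ?_⟩
  simp only [RCLike.re_to_complex, Complex.ofReal_re]
  refine integral_nonneg_of_ae ((ae_left h).mono fun p hp => ?_)
  exact mul_nonneg hp.1 (by positivity)

lemma symbol_mul_mul_ae {A B : M} {a b : X → ℂ} (hA : IsD a (A : H →L[ℂ] H))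
    (hb : BoundedBorel b) (hB : IsD b (B : H →L[ℂ] H)) (T : M) :
    symbol (A * T * B) =ᵐ[ν] fun p => a p.1.1 * b p.1.2 * symbol T p := by
  have h : symbol (A * T * B) = (A : H →L[ℂ] H) ((T : H →L[ℂ] H) ((B : H →L[ℂ] H) chiΔ)) := rfl
  rw [h]
  exact symbol_bimodule (isD_iff.1 hA) hb (isD_iff.1 hB) T

lemma schurMap_bimodule (A B T : M) (hA : (A : H →L[ℂ] H) ∈ cartanMasa)
    (hB : (B : H →L[ℂ] H) ∈ cartanMasa) :
    schurMap chiΔInf (A * T * B) = A * schurMap chiΔInf T * B := by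
  obtain ⟨a, -, ha⟩ := hA
  obtain ⟨b, hb, hB⟩ := hB
  refine schurMap_eq_iff.2 ?_
  filter_upwards [symbol_mul_mul_ae ha hb hB T, symbol_mul_mul_ae ha hb hB (schurMap chiΔInf T),
    symbol_schurMap_ae T] with p h1 h2 h3
  rw [h2, h3]
  by_cases hp : p ∈ Δ
  · rw [Set.indicator_of_mem hp, Set.indicator_of_mem hp, h1]
  · rw [Set.indicator_of_notMem hp, Set.indicator_of_notMem hp, mul_zero]

lemma isCondExpOntoMasa_schurMap : IsCondExpOntoMasa (schurMap chiΔInf) where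
  map_add S T := by
    refine symbol_injective ?_
    have : symbol (S + T) = symbol S + symbol T := rfl
    change _ = symbol (schurMap chiΔInf S) + symbol (schurMap chiΔInf T)
    rw [symbol_schurMap, symbol_schurMap, symbol_schurMap, this, pmul, pmul, pmul]
    exact Lp.add_smul _ _ _
  map_smul c T := by
    refine symbol_injective ?_
    have : symbol (c • T) = c • symbol T := rfl
    change _ = c • symbol (schurMap chiΔInf T)
    rw [symbol_schurMap, symbol_schurMap, this, pmul, pmul, Lp.smul_comm]
  norm_le T := by
    obtain ⟨α, -, hbd, -, hm⟩ := exists_isMul_schurMap T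
    exact ContinuousLinearMap.opNorm_le_bound _ (norm_nonneg _)
      fun ξ => hm.norm_apply_le (fun p => hbd p.1.1) ξ
  positive T hT := by
    obtain ⟨α, -, -, hae, hm⟩ := exists_isMul_schurMap T
    refine hm.isPositive ?_
    filter_upwards [hae, symbol_diag_nonneg hT] with x h1 h2
    rwa [← h1]
  faithful T hT := by
    refine eq_zero_of_symbol_eq_zero ?_
    -- The trace is the vector state at χ_Δ, so τ(T*T) = ‖s(T)‖²; it vanishes because the
    -- expectation preserves τ.
    have h := trace_schurMap (star T * T)
    rw [hT, trace_eq_inner, trace_eq_inner] at h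
    have h0 : symbol 0 = 0 := rfl
    have h1 : symbol (star T * T) = star (T : H →L[ℂ] H) (symbol T) := rfl
    rw [h0, inner_zero_right, h1, ContinuousLinearMap.star_eq_adjoint,
      ContinuousLinearMap.adjoint_inner_right] at h
    exact inner_self_eq_zero.1 h.symm
  range_eq := by
    ext D
    constructor
    · rintro ⟨T, rfl⟩
      obtain ⟨α, hα, -, -, hm⟩ := exists_isMul_schurMap T
      exact hm.mem_cartanMasa hα
    · intro hD
      obtain ⟨T, rfl⟩ : ∃ T : M, (T : H →L[ℂ] H) = D := ⟨⟨D, cartanMasa_subset hD⟩, rfl⟩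
      refine ⟨T, ?_⟩
      simp only [schurMap_of_mem_cartanMasa hD]
  map_of_mem _ := schurMap_of_mem_cartanMasa
  bimodule := schurMap_bimodule
  trace_eq := trace_schurMap

/-! ### Row and column bounded series of operators -/

section Series

variable {A B : ℕ → H →L[ℂ] H} {C : ℝ}

lemma sum_norm_sq_le (hB : ∀ n, ‖∑ i ∈ Finset.range n, star (B i) * B i‖ ≤ C) (ξ : H) (n : ℕ) :
    ∑ i ∈ Finset.range n, ‖B i ξ‖ ^ 2 ≤ C * ‖ξ‖ ^ 2 := by
  have h1 : ∀ i, ‖B i ξ‖ ^ 2 = (inner ℂ ξ ((star (B i) * B i) ξ)).re := fun i => by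
    rw [mul_apply_eq_comp, ContinuousLinearMap.star_eq_adjoint,
      ContinuousLinearMap.adjoint_inner_right, inner_self_eq_norm_sq_to_K]
    norm_cast
  have h2 : ∑ i ∈ Finset.range n, ‖B i ξ‖ ^ 2 =
      (inner ℂ ξ ((∑ i ∈ Finset.range n, star (B i) * B i) ξ)).re := by
    rw [_root_.sum_apply, inner_sum, Complex.re_sum]
    exact Finset.sum_congr rfl fun i _ => h1 i
  rw [h2]
  refine (Complex.re_le_norm _).trans ((norm_inner_le_norm _ _).trans ?_)
  refine (mul_le_mul_of_nonneg_left
    ((ContinuousLinearMap.le_opNorm _ ξ).trans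
      (mul_le_mul_of_nonneg_right (hB n) (norm_nonneg _))) (norm_nonneg _)).trans_eq ?_
  ring

lemma summable_norm_sq (hB : ∀ n, ‖∑ i ∈ Finset.range n, star (B i) * B i‖ ≤ C) (ξ : H) :
    Summable fun i => ‖B i ξ‖ ^ 2 :=
  summable_of_sum_range_le (fun _ => by positivity) (sum_norm_sq_le hB ξ)

lemma sum_finset_norm_sq_le (hB : ∀ n, ‖∑ i ∈ Finset.range n, star (B i) * B i‖ ≤ C) (ξ : H)
    (s : Finset ℕ) : ∑ i ∈ s, ‖B i ξ‖ ^ 2 ≤ C * ‖ξ‖ ^ 2 :=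
  ((summable_norm_sq hB ξ).sum_le_tsum s fun _ _ => by positivity).trans
    (Real.tsum_le_of_sum_range_le (fun _ => by positivity) (sum_norm_sq_le hB ξ))

lemma le_mul_of_sq_le {c x y : ℝ} (hy : 0 ≤ c * y) (h : x ^ 2 ≤ c * x * y) :
    x ≤ c * y := by
  by_contra! hlt
  nlinarith

/-- Pair the sum ζ with itself and move each A_i across. Cauchy–Schwarz and the bound Σ‖A_i* ζ‖² ≤
C‖ζ‖² give ‖ζ‖⁴ ≤ C‖ζ‖² Σ‖η_i‖², and one factor ‖ζ‖² cancels. -/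
lemma norm_sq_sum_apply_le (hA : ∀ n, ‖∑ i ∈ Finset.range n, A i * star (A i)‖ ≤ C)
    (η : ℕ → H) (s : Finset ℕ) :
    ‖∑ i ∈ s, A i (η i)‖ ^ 2 ≤ C * ∑ i ∈ s, ‖η i‖ ^ 2 := by
  have hA' : ∀ n, ‖∑ i ∈ Finset.range n, star (star (A i)) * star (A i)‖ ≤ C := by
    simpa only [star_star] using hA
  set ζ := ∑ i ∈ s, A i (η i) with hζ
  have h1 : ‖ζ‖ ^ 2 ≤ ∑ i ∈ s, ‖star (A i) ζ‖ * ‖η i‖ := by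
    have h2 : ((‖ζ‖ ^ 2 : ℝ) : ℂ) = ∑ i ∈ s, inner ℂ (star (A i) ζ) (η i) := by
      have h3 : ((‖ζ‖ ^ 2 : ℝ) : ℂ) = inner ℂ ζ ζ := by
        rw [inner_self_eq_norm_sq_to_K]
        norm_cast
      rw [h3]
      nth_rewrite 2 [hζ]
      rw [inner_sum]
      refine Finset.sum_congr rfl fun i _ => ?_
      rw [ContinuousLinearMap.star_eq_adjoint, ContinuousLinearMap.adjoint_inner_left]
    have h4 : ‖ζ‖ ^ 2 = ‖((‖ζ‖ ^ 2 : ℝ) : ℂ)‖ := by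
      rw [Complex.norm_real, Real.norm_of_nonneg (by positivity)]
    rw [h4, h2]
    exact (norm_sum_le _ _).trans (Finset.sum_le_sum fun i _ => norm_inner_le_norm _ _)
  have h5 : (‖ζ‖ ^ 2) ^ 2 ≤ C * ‖ζ‖ ^ 2 * ∑ i ∈ s, ‖η i‖ ^ 2 := by
    refine (pow_le_pow_left₀ (by positivity) h1 2).trans
      ((Finset.sum_mul_sq_le_sq_mul_sq _ _ _).trans ?_)
    gcongr
    exact sum_finset_norm_sq_le hA' ζ s
  exact le_mul_of_sq_le (mul_nonneg ((norm_nonneg _).trans (hA 0))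
    (Finset.sum_nonneg fun _ _ => by positivity)) h5

lemma summable_apply_apply (hA : ∀ n, ‖∑ i ∈ Finset.range n, A i * star (A i)‖ ≤ C)
    (hB : ∀ n, ‖∑ i ∈ Finset.range n, star (B i) * B i‖ ≤ C) (T : H →L[ℂ] H) (ξ : H) :
    Summable fun i => A i (T (B i ξ)) := by
  have hC : 0 ≤ C := (norm_nonneg _).trans (hA 0)
  rw [summable_iff_vanishing_norm]
  intro ε hε
  have hs : Summable fun i => C * ‖T (B i ξ)‖ ^ 2 := by
    refine Summable.mul_left C (Summable.of_nonneg_of_le (fun _ => by positivity) (fun i => ?_)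
      ((summable_norm_sq hB ξ).mul_left (‖T‖ ^ 2)))
    rw [← mul_pow]
    gcongr
    exact T.le_opNorm _
  obtain ⟨s, hs⟩ := summable_iff_vanishing_norm.1 hs (ε ^ 2) (by positivity)
  refine ⟨s, fun t ht => lt_of_pow_lt_pow_left₀ 2 hε.le ?_⟩
  refine (norm_sq_sum_apply_le hA (fun i => T (B i ξ)) t).trans_lt ?_
  rw [Finset.mul_sum]
  exact (Real.le_norm_self _).trans_lt (hs t ht)

/-- A strongly convergent series of elements of `M(R)` has its sum in `M(R)`. -/
lemma exists_strong_sum {G : ℕ → M} (hG : ∀ ξ, Summable fun i => (G i : H →L[ℂ] H) ξ) :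
    ∃ S : M, ∀ ξ, HasSum (fun i => (G i : H →L[ℂ] H) ξ) ((S : H →L[ℂ] H) ξ) := by
  have ht : Tendsto (fun n ξ => (∑ i ∈ Finset.range n, (G i : H →L[ℂ] H)) ξ) atTop
      (𝓝 fun ξ => ∑' i, (G i : H →L[ℂ] H) ξ) := by
    refine tendsto_pi_nhds.2 fun ξ => ?_
    simpa only [_root_.sum_apply] using (hG ξ).hasSum.tendsto_sum_nat
  -- Banach–Steinhaus makes the pointwise limit a bounded operator.
  let S : H →L[ℂ] H := continuousLinearMapOfTendsto
    (fun n => ∑ i ∈ Finset.range n, (G i : H →L[ℂ] H)) ht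
  have hS : ∀ ξ, HasSum (fun i => (G i : H →L[ℂ] H) ξ) (S ξ) := fun ξ => (hG ξ).hasSum
  refine ⟨⟨S, mem_vNAlg_iff.2 fun W hW => ContinuousLinearMap.ext fun ξ => ?_⟩, hS⟩
  refine ((hS ξ).mapL W).unique ?_
  have h : (fun i => W ((G i : H →L[ℂ] H) ξ)) = fun i => (G i : H →L[ℂ] H) (W ξ) :=
    funext fun i => DFunLike.congr_fun (mem_vNAlg_iff.1 (G i).2 W hW) ξ
  rw [h]
  exact hS (W ξ)

end Series

/-! ### The multipliers of the extended Haagerup tensor product -/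

lemma BoundedBorel.memLp {a : X → ℂ} (ha : BoundedBorel a) (p : ℝ≥0∞) :
    MemLp a p (volume : Measure X) :=
  let ⟨C, hC⟩ := ha.bounded
  MemLp.of_bound ha.measurable.aestronglyMeasurable C (ae_of_all _ hC)

lemma BoundedBorel.integrable_norm_sq {a : X → ℂ} (ha : BoundedBorel a) :
    Integrable (fun x : X => ‖a x‖ ^ 2) :=
  (ha.memLp 2).norm.integrable_sq

lemma IsMul.integral_norm_sq_le {a : X → ℂ} {D : H →L[ℂ] H} (hD : IsMul (fun p => a p.1.1) D) :
    ∫ x : X, ‖a x‖ ^ 2 ≤ ‖D chiΔ‖ ^ 2 := by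
  refine Eq.trans_le (integral_congr_ae ?_) (integral_diag_norm_sq_le _)
  filter_upwards [ae_diag (hD chiΔ), ae_diag chiΔ_ae] with x h1 h2
  rw [h1, h2]
  rw [Set.indicator_of_mem (s := Δ) (show diag x ∈ Δ from rfl), mul_one, diag]

lemma summable_integral_norm_sq {B : ℕ → H →L[ℂ] H} {b : ℕ → X → ℂ} {C : ℝ}
    (hb : ∀ i, IsMul (fun p => b i p.1.1) (B i))
    (hB : ∀ n, ‖∑ i ∈ Finset.range n, star (B i) * B i‖ ≤ C) :
    Summable fun i => ∫ x : X, ‖b i x‖ ^ 2 :=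
  (summable_norm_sq hB chiΔ).of_nonneg_of_le (fun _ => integral_nonneg fun _ => by positivity)
    fun i => (hb i).integral_norm_sq_le

lemma summable_integral_norm_sq_star {A : ℕ → H →L[ℂ] H} {a : ℕ → X → ℂ} {C : ℝ}
    (hab : ∀ i, BoundedBorel (a i)) (ha : ∀ i, IsMul (fun p => a i p.1.1) (A i))
    (hA : ∀ n, ‖∑ i ∈ Finset.range n, A i * star (A i)‖ ≤ C) :
    Summable fun i => ∫ x : X, ‖a i x‖ ^ 2 := by
  have h : Summable fun i => ∫ x : X, ‖starRingEnd ℂ (a i x)‖ ^ 2 := by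
    refine summable_integral_norm_sq (B := fun i => star (A i)) (C := C) (fun i => ?_) ?_
    · obtain ⟨K, hK⟩ := (hab i).bounded
      exact (ha i).star ((hab i).measurable.comp measurable_left) fun p => hK p.1.1
    · simpa only [star_star] using hA
  simpa using h

lemma ae_summable_of_summable_integral {α : Type*} [MeasurableSpace α] {m : Measure α}
    {f : ℕ → α → ℝ} (hf : ∀ i, Integrable (f i) m) (h0 : ∀ i x, 0 ≤ f i x)
    (hs : Summable fun i => ∫ x, f i x ∂m) : ∀ᵐ x ∂m, Summable fun i => f i x := by
  have hm : ∀ i, AEMeasurable (fun x => ENNReal.ofReal (f i x)) m :=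
    fun i => (hf i).aemeasurable.ennreal_ofReal
  have h : ∫⁻ x, ∑' i, ENNReal.ofReal (f i x) ∂m ≠ ∞ := by
    rw [lintegral_tsum hm]
    have : ∀ i, ∫⁻ x, ENNReal.ofReal (f i x) ∂m = ENNReal.ofReal (∫ x, f i x ∂m) :=
      fun i => (ofReal_integral_eq_lintegral_ofReal (hf i) (ae_of_all _ (h0 i))).symm
    simp_rw [this]
    exact hs.tsum_ofReal_ne_top
  filter_upwards [ae_lt_top' (AEMeasurable.tsum hm) h] with x hx
  simpa only [ENNReal.toReal_ofReal (h0 _ x)] using ENNReal.summable_toReal hx.ne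

lemma norm_mul_le_half (z w : ℂ) : ‖z * w‖ ≤ (‖z‖ ^ 2 + ‖w‖ ^ 2) / 2 := by
  rw [norm_mul]
  nlinarith [sq_nonneg (‖z‖ - ‖w‖)]

lemma summable_mul_of_summable_norm_sq {z w : ℕ → ℂ} (hz : Summable fun i => ‖z i‖ ^ 2)
    (hw : Summable fun i => ‖w i‖ ^ 2) : Summable fun i => z i * w i :=
  Summable.of_norm_bounded ((hz.add hw).div_const 2) fun i => norm_mul_le_half (z i) (w i)

/-- `φ_u` is a Schur multiplier, with Schur multiplication map `T ↦ ∑ A_i T B_i`. -/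
lemma ehMultipliers_subset : ehMultipliers ⊆ schurMultipliers := by
  rintro φ ⟨u, a, b, ha, hb, hφ⟩ _ ⟨T, rfl⟩
  obtain ⟨C, hC⟩ := u.bounded
  have ha' := fun i => isD_iff.1 (ha i).2
  have hb' := fun i => isD_iff.1 (hb i).2
  let G : ℕ → M := fun i =>
    ⟨u.A i, cartanMasa_subset (u.A_mem i)⟩ * T * ⟨u.B i, cartanMasa_subset (u.B_mem i)⟩
  have hG : ∀ i ξ, (G i : H →L[ℂ] H) ξ = u.A i ((T : H →L[ℂ] H) (u.B i ξ)) := fun _ _ => rfl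
  obtain ⟨S, hS⟩ := exists_strong_sum (G := G) fun ξ => by
    simpa only [hG] using
      summable_apply_apply (fun n => (hC n).1) (fun n => (hC n).2) (T : H →L[ℂ] H) ξ
  refine ⟨S, Lp.ext ?_⟩
  have has : ∀ᵐ x : X, Summable fun i => ‖a i x‖ ^ 2 :=
    ae_summable_of_summable_integral (fun i => (ha i).1.integrable_norm_sq)
      (fun _ _ => by positivity)
      (summable_integral_norm_sq_star (fun i => (ha i).1) ha' fun n => (hC n).1)
  have hbs : ∀ᵐ x : X, Summable fun i => ‖b i x‖ ^ 2 :=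
    ae_summable_of_summable_integral (fun i => (hb i).1.integrable_norm_sq)
      (fun _ _ => by positivity)
      (summable_integral_norm_sq hb' fun n => (hC n).2)
  -- Strong convergence at χ_Δ is only L² convergence of symbols. An almost everywhere convergent
  -- subsequence identifies the limit with the pointwise sum.
  obtain ⟨ns, hns, hae⟩ :=
    (tendstoInMeasure_of_tendsto_Lp (hS chiΔ).tendsto_sum_nat).exists_seq_tendsto_ae
  have hterm : ∀ᵐ p ∂ν, ∀ i, (G i : H →L[ℂ] H) chiΔ p = a i p.1.1 * b i p.1.2 * symbol T p :=
    ae_all_iff.2 fun i => symbol_bimodule (ha' i) (hb i).1 (hb' i) T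
  have hsum : ∀ᵐ p ∂ν, ∀ n, (∑ i ∈ Finset.range n, (G i : H →L[ℂ] H) chiΔ : H) p =
      ∑ i ∈ Finset.range n, (G i : H →L[ℂ] H) chiΔ p :=
    ae_all_iff.2 fun n => (Lp.coeFn_finsetSum _ _).mono fun p hp => by
      rw [hp, Finset.sum_apply]
  filter_upwards [hae, hterm, hsum, ae_left has, ae_right hbs, hφ, pmul_ae φ (symbol T)]
    with p h1 h2 h3 h4 h5 h6 h7
  simp only [h3, h2] at h1
  have h8 :=
    ((summable_mul_of_summable_norm_sq h4 h5).hasSum.mul_right (symbol T p)).tendsto_sum_nat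
  rw [h7, h6]
  exact tendsto_nhds_unique h1 (h8.comp hns.tendsto_atTop)

/-! ### The diagonal is not such a multiplier -/

/-- The integral is the inner product of the conjugate of b with a translate of a, and translation
is strongly continuous on L². -/
lemma continuous_integral_translate {a b : X → ℂ} (ha : BoundedBorel a) (hb : BoundedBorel b) :
    Continuous fun r : X => ∫ y : X, a (y + r) * b y := by
  have hmp : ∀ r : X, MeasurePreserving (fun y : X => y + r) volume volume :=
    fun r => measurePreserving_add_right volume r
  have hg : Continuous fun r : X => (⟨fun y : X => y + r, by fun_prop⟩ : C(X, X)) :=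
    ContinuousMap.continuous_of_continuous_uncurry _ (continuous_snd.add continuous_fst)
  have hc : MemLp (fun y => starRingEnd ℂ (b y)) 2 (volume : Measure X) :=
    (hb.memLp 2).star
  have h := (continuous_const (y := hc.toLp)).inner (𝕜 := ℂ)
    ((continuous_const (y := (ha.memLp 2).toLp)).compMeasurePreservingLp hg hmp (by simp))
  refine h.congr fun r => ?_
  rw [L2.inner_def]
  refine integral_congr_ae ?_
  filter_upwards [hc.coeFn_toLp, Lp.coeFn_compMeasurePreserving (ha.memLp 2).toLp (hmp r),
    (hmp r).quasiMeasurePreserving.ae (ha.memLp 2).coeFn_toLp] with y h1 h2 h3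
  simp only [ContinuousMap.coe_mk] at h2 ⊢
  rw [h1, h2]
  simp only [Function.comp_apply, h3, RCLike.inner_apply, starRingEnd_self_apply]

lemma norm_integral_translate_le {a b : X → ℂ} (ha : BoundedBorel a) (hb : BoundedBorel b)
    (r : X) : ∫ y : X, ‖a (y + r) * b y‖ ≤
      ((∫ x : X, ‖a x‖ ^ 2) + ∫ x : X, ‖b x‖ ^ 2) / 2 := by
  have h1 : Integrable (fun y : X => ‖a (y + r)‖ ^ 2) :=
    ha.integrable_norm_sq.comp_add_right r
  rw [← integral_add_right_eq_self (fun x : X => ‖a x‖ ^ 2) r,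
    ← integral_add h1 hb.integrable_norm_sq, ← integral_div]
  exact integral_mono_of_nonneg (ae_of_all _ fun _ => norm_nonneg _)
    ((h1.add hb.integrable_norm_sq).div_const 2) (ae_of_all _ fun y => norm_mul_le_half _ _)

/-- The integrals of `f_u` over the graphs of the translations depend continuously on the
translation. -/
lemma continuous_integral_tsum {a b : ℕ → X → ℂ} (ha : ∀ i, BoundedBorel (a i))
    (hb : ∀ i, BoundedBorel (b i)) (has : Summable fun i => ∫ x : X, ‖a i x‖ ^ 2)
    (hbs : Summable fun i => ∫ x : X, ‖b i x‖ ^ 2) :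
    Continuous fun r : X => ∫ y : X, ∑' i, a i (y + r) * b i y := by
  have hle := fun i => norm_integral_translate_le (ha i) (hb i)
  have hs := (has.add hbs).div_const 2
  -- Weierstrass test: translation invariance makes the bound on each term independent of r.
  have h := continuous_tsum (fun i => continuous_integral_translate (ha i) (hb i)) hs
    fun i r => (norm_integral_le_integral_norm _).trans (hle i r)
  refine h.congr fun r => (hasSum_integral_of_summable_integral_norm (fun i => ?_)
    (hs.of_nonneg_of_le (fun _ => integral_nonneg fun _ => norm_nonneg _)
      fun i => hle i r)).tsum_eq
  have h1 : MemLp (fun y : X => a i (y + r)) 2 volume :=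
    ((ha i).memLp 2).comp_measurePreserving (measurePreserving_add_right volume r)
  exact h1.integrable_mul ((hb i).memLp 2)

/-- The dyadic rational `1 / 2 ^ n`. -/
def dyadicPow (n : ℕ) : dyadic := ⟨((1 / 2 ^ n : ℝ) : X), n, 1, by simp⟩

/-- The case n = 0 is excluded because 1/2⁰ = 1 is zero on the circle. -/
lemma dyadicPow_ne_zero {n : ℕ} (hn : n ≠ 0) : (dyadicPow n : X) ≠ 0 := by
  intro h
  obtain ⟨m, hm⟩ := (AddCircle.coe_eq_zero_iff (1 : ℝ)).1 h
  have h0 : (0 : ℝ) < 1 / 2 ^ n := by positivity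
  have h1 : (1 / 2 ^ n : ℝ) < 1 := by
    rw [div_lt_one (by positivity)]
    exact one_lt_pow₀ one_lt_two hn
  rw [← hm, zsmul_eq_mul, mul_one] at h0 h1
  norm_cast at h0 h1
  lia

lemma tendsto_dyadicPow : Tendsto (fun n => (dyadicPow n : X)) atTop (𝓝 0) := by
  have h : Tendsto (fun n : ℕ => (1 / 2 ^ n : ℝ)) atTop (𝓝 0) := by
    simpa using tendsto_pow_atTop_nhds_zero_of_lt_one (r := (1 / 2 : ℝ)) (by norm_num)
      (by norm_num)
  exact ((AddCircle.continuous_mk' (1 : ℝ)).tendsto 0).comp h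

/-- A function of the form `∑ a_i(x) b_i(y)` with square integrable sequences `a` and `b` does not
agree almost everywhere with the characteristic function of the diagonal. -/
lemma indicator_Δ_not_ae_eq_tsum {a b : ℕ → X → ℂ} (ha : ∀ i, BoundedBorel (a i))
    (hb : ∀ i, BoundedBorel (b i)) (has : Summable fun i => ∫ x : X, ‖a i x‖ ^ 2)
    (hbs : Summable fun i => ∫ x : X, ‖b i x‖ ^ 2) :
    ¬ (Δ.indicator fun _ => (1 : ℂ)) =ᵐ[ν] fun p => ∑' i, a i p.1.1 * b i p.1.2 := by
  intro hχ
  have hcont := continuous_integral_tsum ha hb has hbs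
  have hfib : ∀ r : dyadic, ∀ᵐ y : X, Δ.indicator (fun _ => (1 : ℂ)) (fiber r y) =
      ∑' i, a i (y + (r : X)) * b i y := fun r => by
    filter_upwards [ae_ν_iff.1 hχ r] with y hy
    exact hy
  have h0 : ∫ y : X, ∑' i, a i (y + 0) * b i y = 1 := by
    have : ∫ y : X, ∑' i, a i (y + 0) * b i y = ∫ _ : X, (1 : ℂ) := by
      refine integral_congr_ae ((hfib 0).mono fun y hy => hy.symm.trans ?_)
      rw [fiber_zero]
      exact Set.indicator_of_mem (s := Δ) (show diag y ∈ Δ from rfl) _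
    rw [this]
    simp [measureReal_def]
  have hn : ∀ n : ℕ, n ≠ 0 → ∫ y : X, ∑' i, a i (y + (dyadicPow n : X)) * b i y = 0 := by
    intro n hn
    refine integral_eq_zero_of_ae ((hfib (dyadicPow n)).mono fun y hy => hy.symm.trans ?_)
    refine Set.indicator_of_notMem (fun h => dyadicPow_ne_zero hn ?_) _
    have h' : y + (dyadicPow n : X) = y := h
    simpa using h'
  have hlim := (hcont.tendsto 0).comp tendsto_dyadicPow
  rw [h0] at hlim
  have hlim0 : Tendsto (fun _ : ℕ => (0 : ℂ)) atTop (𝓝 1) :=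
    hlim.congr' ((eventually_ne_atTop 0).mono fun n h => hn n h)
  exact zero_ne_one (tendsto_nhds_unique tendsto_const_nhds hlim0)

lemma chiΔInf_notMem_ehMultipliers : chiΔInf ∉ ehMultipliers := by
  rintro ⟨u, a, b, ha, hb, hφ⟩
  obtain ⟨C, hC⟩ := u.bounded
  refine indicator_Δ_not_ae_eq_tsum (fun i => (ha i).1) (fun i => (hb i).1)
    (summable_integral_norm_sq_star (fun i => (ha i).1) (fun i => isD_iff.1 (ha i).2)
      fun n => (hC n).1)
    (summable_integral_norm_sq (fun i => isD_iff.1 (hb i).2) fun n => (hC n).2) ?_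
  exact (indicatorConstLp_coeFn (p := ∞) (hs := measurableSet_Δ)
    (hμs := ν_Δ_ne_top)).symm.trans hφ

end DyadicCartan

end

theorem corollary6p9 :
    DyadicCartan.ehMultipliers ⊂ DyadicCartan.schurMultipliers ∧
    Function.Injective DyadicCartan.symbol ∧
    DyadicCartan.chiΔInf ∈ DyadicCartan.schurMultipliers ∧
    DyadicCartan.IsCondExpOntoMasa (DyadicCartan.schurMap DyadicCartan.chiΔInf) ∧
    DyadicCartan.chiΔInf ∉ DyadicCartan.ehMultipliers :=
  ⟨⟨DyadicCartan.ehMultipliers_subset, fun h => DyadicCartan.chiΔInf_notMem_ehMultipliers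
      (h DyadicCartan.chiΔInf_mem_schurMultipliers)⟩,
    DyadicCartan.symbol_injective, DyadicCartan.chiΔInf_mem_schurMultipliers,
    DyadicCartan.isCondExpOntoMasa_schurMap, DyadicCartan.chiΔInf_notMem_ehMultipliers⟩
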